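/- Let $\mathbb{O}=\mathbb{R}^8$ be the octonions with standard basis $e_0=1,e_1,\dots,e_7$ and $e_ie_j=-\delta_{ij}+\sum_k\epsilon_{ijk}e_k$ for $i,j\ge 1$, where $\epsilon_{ijk}$ is totally antisymmetric, equals $1$ on the triples $(1,2,3),(1,4,5),(2,4,6),(3,4,7),(5,3,6),(6,1,7),(7,2,5)$, and vanishes off their permutations. Fix $0\le p\le 6$. Write each $\boldsymbol{x}\in\mathbb{O}$ as $\boldsymbol{x}=\boldsymbol{x}_p+r\underline{\omega}$ with $\boldsymbol{x}_p=\sum_{i=0}^p x_ie_i$, identified with $(x_0,\dots,x_p)\in\mathbb{R}^{p+1}$, $r\ge 0$, and $\underline{\omega}$ in the unit sphere of $\mathrm{span}_{\mathbb{R}}(e_{p+1},\dots,e_7)$ (when $r=0$, $\underline{\omega}$ is arbitrary and the functions below do not depend on it). The Fueter variables are $z_\ell(\boldsymbol{x})=x_\ell+r\underline{\omega}e_\ell$, $0\le\ell\le p$. For a polynomial $f_0:\mathbb{R}^{p+1}\to\mathbb{O}$ let $$CK[f_0](\boldsymbol{x})=\sum_{j\ge 0}\frac{r^{2j}}{(2j)!}(-\Delta)^jf_0(\boldsymbol{x}_p)+\underline{\omega}\sum_{j\ge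 0}\frac{r^{2j+1}}{(2j+1)!}(-\Delta)^j(Df_0)(\boldsymbol{x}_p),$$ where $\Delta=\sum_{i=0}^p\partial_{x_i}^2$ and $D=\sum_{i=0}^p e_i\partial_{x_i}$. For $\mathrm{k}=(k_0,\dots,k_p)\in\mathbb{N}^{p+1}$ put $|\mathrm{k}|=k_0+\dots+k_p$, $\mathrm{k}!=k_0!\cdots k_p!$ and $$V_{\mathrm{k}}=\frac{1}{\mathrm{k}!}CK[x_0^{k_0}\cdots x_p^{k_p}],\qquad \mathcal{P}_{\mathrm{k}}=\frac{1}{|\mathrm{k}|!}\sum_{(i_1,\dots,i_{|\mathrm{k}|})}\big(\cdots((z_{i_1}z_{i_2})z_{i_3})\cdots\big)z_{i_{|\mathrm{k}|}},$$ where the sum runs over all sequences in $\{0,\dots,p\}^{|\mathrm{k}|}$ in which each $\ell$ occurs exactly $k_\ell$ times (and $\mathcal{P}_{\mathbf{0}}=1$). Theorem. For every $\mathrm{k}\in\mathbb{N}^{p+1}$ and every $\boldsymbol{x}\in\mathbb{O}$, $$V_{\mathrm{k}}(\boldsymbol{x})=\mathcal{P}_{\mathrm{k}}(\boldsymbol{x}).$$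 Moreover $\mathcal{P}_{\mathrm{k}}$ does not depend on the bracketing: for $|\mathrm{k}|\ge 1$, if in the definition of $\mathcal{P}_{\mathrm{k}}$ every product $z_{i_1}z_{i_2}\cdots z_{i_{|\mathrm{k}|}}$ is instead evaluated with one and the same arbitrary complete bracketing of $|\mathrm{k}|$ ordered factors, the resulting function is again $\mathcal{P}_{\mathrm{k}}$. -/

import Mathlib

open scoped BigOperators

namespace OctonionFueter

noncomputable section

/-! ## The octonions -/

/-- The seven oriented triples that determine the multiplication table. -/
def triples : List (Fin 8 × Fin 8 × Fin 8) :=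
  [(1, 2, 3), (1, 4, 5), (2, 4, 6), (3, 4, 7), (5, 3, 6), (6, 1, 7), (7, 2, 5)]

/-- The symbol `ε i j k`: the sign of the permutation that carries one of the seven triples to
`(i, j, k)`, and `0` if there is none. -/
def epsilon (i j k : Fin 8) : ℤ :=
  if (i, j, k) ∈ triples ∨ (j, k, i) ∈ triples ∨ (k, i, j) ∈ triples then 1
  else if (j, i, k) ∈ triples ∨ (i, k, j) ∈ triples ∨ (k, j, i) ∈ triples then -1
  else 0

/-- The coefficient of `e k` in the product `e i * e j`: the element `e 0` is the unit, and
`e i * e j = -δ i j + ∑ k, ε i j k e k` for `i, j ≥ 1`. -/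
def structConst (i j k : Fin 8) : ℤ :=
  if i = 0 then (if k = j then 1 else 0)
  else if j = 0 then (if k = i then 1 else 0)
  else (if k = 0 ∧ i = j then -1 else 0) + epsilon i j k

/-- The octonions: the Euclidean space `ℝ⁸`, with the multiplication given below. -/
abbrev Octonion : Type := EuclideanSpace ℝ (Fin 8)

/-- The octonion product: the bilinear extension of the multiplication table. -/
instance instMulOctonion : Mul Octonion where
  mul x y := WithLp.toLp 2 fun k => ∑ i, ∑ j, (structConst i j k : ℝ) * (x i * y j)

/-- The standard basis `e 0 = 1, e 1, …, e 7`. -/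
def e (i : Fin 8) : Octonion := EuclideanSpace.single i 1

/-! ## The splitting `ℝ⁸ = ℝ^(p+1) ⊕ ℝ^q`, `0 ≤ p ≤ 6`, `q = 7 - p` -/

/-- The inclusion of the indices `0, …, p` into `0, …, 7`. -/
def idx (p : Fin 7) : Fin (p.val + 1) → Fin 8 := Fin.castLE (by omega)

/-- The component of `x` in `ℝ^(p+1)`, as the tuple `(x_0, …, x_p)`. -/
def headPart (p : Fin 7) (x : Octonion) : Fin (p.val + 1) → ℝ := fun l => x (idx p l)

/-- The octonion `x_0 + x_1 e_1 + ⋯ + x_p e_p`. -/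
def ofHead (p : Fin 7) (y : Fin (p.val + 1) → ℝ) : Octonion := ∑ l, y l • e (idx p l)

/-- The component `x_{p+1} e_{p+1} + ⋯ + x_7 e_7` of `x`. -/
def tailPart (p : Fin 7) (x : Octonion) : Octonion :=
  WithLp.toLp 2 fun i => if i.val ≤ p.val then 0 else x i

/-- The unit sphere of `ℝ^q`. -/
def unitSphere (p : Fin 7) : Set Octonion :=
  {ω | (∀ i : Fin 8, i.val ≤ p.val → ω i = 0) ∧ ∑ i, ω i ^ 2 = 1}

/-- `r`, the modulus of the component in `ℝ^q`. -/
def radius (p : Fin 7) (x : Octonion) : ℝ := ‖tailPart p x‖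

/-- A direction `ω` in the unit sphere of `ℝ^q` with `x = x_p + r ω`.  It is unique when `r ≠ 0`;
when `r = 0` every `ω` will do, and `e 7` is taken. -/
def direction (p : Fin 7) (x : Octonion) : Octonion :=
  if radius p x = 0 then e 7 else (radius p x)⁻¹ • tailPart p x

/-! ## Fueter variables and Fueter polynomials -/

/-- The value `x_l + (r ω) e_l` of the `l`-th left Fueter variable at `x_p + r ω`. -/
def fueterVarAt (p : Fin 7) (y : Fin (p.val + 1) → ℝ) (r : ℝ) (ω : Octonion)
    (l : Fin (p.val + 1)) : Octonion :=
  y l • e 0 + (r • ω) * e (idx p l)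

/-- The left Fueter variable `z_l`, as a function on the octonions. -/
def fueterVar (p : Fin 7) (l : Fin (p.val + 1)) (x : Octonion) : Octonion :=
  fueterVarAt p (headPart p x) (radius p x) (direction p x) l

/-- The associative orders (complete bracketings) of a product of `n` ordered factors. -/
inductive Bracketing : ℕ → Type
  | leaf : Bracketing 1
  | node {m n : ℕ} (a : Bracketing m) (b : Bracketing n) : Bracketing (m + n)

/-- The product of the ordered factors `v 0, …, v (n - 1)` in a given associative order. -/
def Bracketing.prod : {n : ℕ} → Bracketing n → (Fin n → Octonion) → Octonion
  | _, .leaf, v => v 0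
  | _, .node (m := m) (n := n) a b, v =>
      a.prod (fun i => v (Fin.castAdd n i)) * b.prod (fun i => v (Fin.natAdd m i))

/-- The product of ordered factors from left to right, `((v 0 * v 1) * v 2) * ⋯`; the product of
no factors is `1`. -/
def leftProd : (n : ℕ) → (Fin n → Octonion) → Octonion
  | 0, _ => e 0
  | 1, v => v 0
  | n + 2, v => leftProd (n + 1) (fun i => v i.castSucc) * v (Fin.last (n + 1))

/-- The total degree `|k|` of a multi-index. -/
abbrev degree {p : Fin 7} (k : Fin (p.val + 1) → ℕ) : ℕ := ∑ l, k l

/-- The distinct rearrangements of the alignment `(0, …, 0, 1, …, 1, …, p, …, p)` in which each `l`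
occurs `k l` times: the index sequences of length `|k|` that take each value `l` exactly `k l`
times. -/
def alignments {p : Fin 7} (k : Fin (p.val + 1) → ℕ) :
    Finset (Fin (degree k) → Fin (p.val + 1)) :=
  Finset.univ.filter fun s => ∀ l, (Finset.univ.filter fun m => s m = l).card = k l

/-- The symmetrized product of the Fueter variables in a given associative order. -/
def fueterPolyWith {p : Fin 7} (k : Fin (p.val + 1) → ℕ) (B : Bracketing (degree k))
    (x : Octonion) : Octonion :=
  ((degree k).factorial : ℝ)⁻¹ • ∑ s ∈ alignments k, B.prod fun m => fueterVar p (s m) x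

/-- The octonionic Fueter polynomial `P_k`, with the products taken from left to right. -/
def fueterPoly {p : Fin 7} (k : Fin (p.val + 1) → ℕ) (x : Octonion) : Octonion :=
  ((degree k).factorial : ℝ)⁻¹ •
    ∑ s ∈ alignments k, leftProd (degree k) fun m => fueterVar p (s m) x

/-! ## The Cauchy-Kovalevskaya extension -/

/-- The partial derivative of an octonion valued function of `(x_0, …, x_p)`. -/
def partialDeriv {p : Fin 7} (l : Fin (p.val + 1)) (f : (Fin (p.val + 1) → ℝ) → Octonion) :
    (Fin (p.val + 1) → ℝ) → Octonion :=
  fun y => lineDeriv ℝ f y (Pi.single l 1)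

/-- `-Δ`, for the Laplacian `Δ` of `ℝ^(p+1)`. -/
def negLaplacian {p : Fin 7} (f : (Fin (p.val + 1) → ℝ) → Octonion) :
    (Fin (p.val + 1) → ℝ) → Octonion :=
  fun y => -∑ l, partialDeriv l (partialDeriv l f) y

/-- The generalized Cauchy-Riemann operator `∑ e_l ∂_l` of `ℝ^(p+1)`. -/
def cauchyRiemann {p : Fin 7} (f : (Fin (p.val + 1) → ℝ) → Octonion) :
    (Fin (p.val + 1) → ℝ) → Octonion :=
  fun y => ∑ l, e (idx p l) * partialDeriv l f y

/-- The value of the extension of `f` at `x_p + r ω`.  The series are finite sums when `f` is a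
polynomial. -/
def ckAt {p : Fin 7} (f : (Fin (p.val + 1) → ℝ) → Octonion) (y : Fin (p.val + 1) → ℝ) (r : ℝ)
    (ω : Octonion) : Octonion :=
  ∑' j : ℕ, (r ^ (2 * j) / ((2 * j).factorial : ℝ)) • (negLaplacian^[j] f) y +
    ω * ∑' j : ℕ, (r ^ (2 * j + 1) / ((2 * j + 1).factorial : ℝ)) •
      (negLaplacian^[j] (cauchyRiemann f)) y

/-- The generalized partial-slice Cauchy-Kovalevskaya extension `CK[f]`, as a function on the
octonions. -/
def ck {p : Fin 7} (f : (Fin (p.val + 1) → ℝ) → Octonion) (x : Octonion) : Octonion :=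
  ckAt f (headPart p x) (radius p x) (direction p x)

/-- The real monomial `x_0 ^ k_0 ⋯ x_p ^ k_p`, as an octonion valued function. -/
def monomialFun {p : Fin 7} (k : Fin (p.val + 1) → ℕ) : (Fin (p.val + 1) → ℝ) → Octonion :=
  fun y => (∏ l, y l ^ k l) • e 0

/-- `V_k = CK[x_p ^ k] / k!`. -/
def ckMonomial {p : Fin 7} (k : Fin (p.val + 1) → ℕ) (x : Octonion) : Octonion :=
  ((∏ l, (k l).factorial : ℕ) : ℝ)⁻¹ • ck (monomialFun k) x

/-! ## The functions above do not depend on the choice of `ω` -/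

theorem mul_apply (x y : Octonion) (k : Fin 8) :
    (x * y) k = ∑ i, ∑ j, (structConst i j k : ℝ) * (x i * y j) := rfl

theorem ofHead_apply (p : Fin 7) (y : Fin (p.val + 1) → ℝ) (i : Fin 8) :
    ofHead p y i = if h : i.val < p.val + 1 then y ⟨i.val, h⟩ else 0 := by
  have key : ofHead p y i = ∑ l, if i = idx p l then y l else 0 := by
    simp [ofHead, e, Pi.single_apply]
  rw [key]
  split_ifs with h
  · rw [Finset.sum_eq_single ⟨i.val, h⟩]
    · simp [idx]
    · intro b _ hb
      rw [if_neg]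
      intro hi
      apply hb
      ext
      simp [hi, idx]
    · simp
  · apply Finset.sum_eq_zero
    intro l _
    rw [if_neg]
    intro hi
    apply h
    rw [hi]
    exact l.2

theorem unitSphere_norm {p : Fin 7} {ω : Octonion} (hω : ω ∈ unitSphere p) : ‖ω‖ = 1 := by
  rw [EuclideanSpace.norm_eq]
  simp [hω.2]

theorem headPart_add {p : Fin 7} (y : Fin (p.val + 1) → ℝ) (r : ℝ) {ω : Octonion}
    (hω : ω ∈ unitSphere p) : headPart p (ofHead p y + r • ω) = y := by
  funext l
  have h0 : ω (idx p l) = 0 := hω.1 _ (by have := l.2; simp [idx]; omega)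
  have hl : (idx p l).val < p.val + 1 := l.2
  simp [headPart, h0, ofHead_apply, hl]
  rfl

theorem tailPart_add {p : Fin 7} (y : Fin (p.val + 1) → ℝ) (r : ℝ) {ω : Octonion}
    (hω : ω ∈ unitSphere p) : tailPart p (ofHead p y + r • ω) = r • ω := by
  ext i
  by_cases h : i.val ≤ p.val
  · simp [tailPart, h, hω.1 i h]
  · simp [tailPart, h, ofHead_apply]

theorem radius_add {p : Fin 7} (y : Fin (p.val + 1) → ℝ) {r : ℝ} (hr : 0 ≤ r) {ω : Octonion}
    (hω : ω ∈ unitSphere p) : radius p (ofHead p y + r • ω) = r := by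
  rw [radius, tailPart_add y r hω, norm_smul, unitSphere_norm hω, Real.norm_of_nonneg hr, mul_one]

theorem direction_add {p : Fin 7} (y : Fin (p.val + 1) → ℝ) {r : ℝ} (hr : 0 < r) {ω : Octonion}
    (hω : ω ∈ unitSphere p) : direction p (ofHead p y + r • ω) = ω := by
  rw [direction, radius_add y hr.le hω, if_neg hr.ne', tailPart_add y r hω, smul_smul,
    inv_mul_cancel₀ hr.ne', one_smul]

/-- Every octonion is `x_p + r ω` with `r` and `ω` as above. -/
theorem eq_head_add (p : Fin 7) (x : Octonion) :
    x = ofHead p (headPart p x) + radius p x • direction p x ∧ 0 ≤ radius p x ∧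
      direction p x ∈ unitSphere p := by
  have ht : radius p x • direction p x = tailPart p x := by
    rw [direction]
    split_ifs with h
    · rw [h, zero_smul]
      exact (norm_eq_zero.1 h).symm
    · rw [smul_smul, mul_inv_cancel₀ h, one_smul]
  refine ⟨?_, norm_nonneg _, ?_⟩
  · rw [ht]
    ext i
    by_cases h : i.val ≤ p.val
    · simp [tailPart, h, ofHead_apply, headPart, show i.val < p.val + 1 by omega, idx]
    · simp [tailPart, h, ofHead_apply, show ¬ i.val < p.val + 1 by omega]
  · rw [direction]
    split_ifs with h
    · refine ⟨fun i hi => ?_, ?_⟩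
      · have : i ≠ 7 := by rintro rfl; have := p.2; simp at hi; omega
        simp [e, this]
      · simp [e, PiLp.single_apply]
    · refine ⟨fun i hi => by simp [tailPart, hi], ?_⟩
      have h1 : ‖(radius p x)⁻¹ • tailPart p x‖ = 1 := by
        rw [norm_smul, norm_inv, Real.norm_of_nonneg (show 0 ≤ radius p x from norm_nonneg _)]
        exact inv_mul_cancel₀ h
      have h2 := EuclideanSpace.real_norm_sq_eq ((radius p x)⁻¹ • tailPart p x)
      rw [← h2, h1, one_pow]

/-- The Fueter variables are given by `x_l + (r ω) e_l` for every representation `x_p + r ω`. -/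
theorem fueterVar_add {p : Fin 7} (l : Fin (p.val + 1)) (y : Fin (p.val + 1) → ℝ) {r : ℝ}
    (hr : 0 ≤ r) {ω : Octonion} (hω : ω ∈ unitSphere p) :
    fueterVar p l (ofHead p y + r • ω) = fueterVarAt p y r ω l := by
  rw [fueterVar, headPart_add y r hω, radius_add y hr hω]
  rcases hr.eq_or_lt with h | h
  · subst h
    simp [fueterVarAt]
  · rw [direction_add y h hω]

/-- The extension is given by its series for every representation `x_p + r ω`. -/
theorem ck_add {p : Fin 7} (f : (Fin (p.val + 1) → ℝ) → Octonion) (y : Fin (p.val + 1) → ℝ) {r : ℝ}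
    (hr : 0 ≤ r) {ω : Octonion} (hω : ω ∈ unitSphere p) :
    ck f (ofHead p y + r • ω) = ckAt f y r ω := by
  rw [ck, headPart_add y r hω, radius_add y hr hω]
  rcases hr.eq_or_lt with h | h
  · subst h
    have hz : ∀ w : Octonion, w * 0 = 0 := by
      intro w
      ext k
      simp [mul_apply]
    simp [ckAt, hz]
  · rw [direction_add y h hω]

end

end OctonionFueter

namespace OctonionFueter

noncomputable section

/-! ## Algebraic properties of the octonion product -/

/-! The proof compares generating functions in a real parameter `t = (t_0, …, t_p)`. Put `u = ω t`,
with `t` read as the octonion `∑ t_l e_l`. Then `∑ t_l z_l = ⟨t, x_p⟩ + r u`. Since `ω` is a unit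
vector orthogonal to `t` with no real part, `u` is purely imaginary of norm `|t|`, so `u² = -|t|²`
(`mul_self_mul_ofHead`). Hence all powers of `∑ t_l z_l` are computed in the commutative associative
algebra `ℝ[u]`, in which brackets are irrelevant (`Bracketing.prod_ofQuadratic`).

Expanding the `n`-th power by multilinearity and grouping sequences by content gives `∑ t^k S_k`
over `|k| = n`, where `S_k` is the sum of the products over the arrangements of `k`. On the other
side, `∑ t^k V_k` is the extension of `⟨t, x_p⟩^n / n!`. For a power of a linear form, `(-Δ)^j` and
`D` only lower the exponent and produce factors `-|t|²` and `t`, so the extension is the binomial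
expansion of `(⟨t, x_p⟩ + r u)^n / n!` (`sum_smul_ckAt_monomialFun`).

Both sides are polynomials in `t`, so their coefficients agree (`eq_of_sum_piAntidiag_smul_eq`). The
same comparison for two bracketings gives the independence of the bracketing. -/

instance instNonUnitalNonAssocRingOctonion : NonUnitalNonAssocRing Octonion :=
  { (inferInstance : AddCommGroup Octonion), instMulOctonion with
    left_distrib := fun x y z => by
      ext k
      simp [mul_apply, mul_add, Finset.sum_add_distrib]
    right_distrib := fun x y z => by
      ext k
      simp [mul_apply, add_mul, mul_add, Finset.sum_add_distrib]
    zero_mul := fun x => by ext k; simp [mul_apply]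
    mul_zero := fun x => by ext k; simp [mul_apply] }

instance instIsScalarTowerOctonion : IsScalarTower ℝ Octonion Octonion where
  smul_assoc c x y := by
    ext k
    simp only [smul_eq_mul, mul_apply, PiLp.smul_apply, Finset.mul_sum]
    exact Finset.sum_congr rfl fun i _ => Finset.sum_congr rfl fun j _ => by ring

instance instSMulCommClassOctonion : SMulCommClass ℝ Octonion Octonion where
  smul_comm c x y := by
    ext k
    simp only [smul_eq_mul, mul_apply, PiLp.smul_apply, Finset.mul_sum]
    exact Finset.sum_congr rfl fun i _ => Finset.sum_congr rfl fun j _ => by ring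

theorem structConst_zero_left (j k : Fin 8) : structConst 0 j k = if k = j then 1 else 0 := by
  simp [structConst]

theorem structConst_zero_right (i k : Fin 8) : structConst i 0 k = if k = i then 1 else 0 := by
  revert i k
  decide

theorem e_zero_mul (x : Octonion) : e 0 * x = x := by
  ext k
  rw [mul_apply, Finset.sum_eq_single 0 _ (by simp)]
  · simp [structConst_zero_left, e]
  · intro i _ hi
    simp [e, hi]

theorem mul_e_zero (x : Octonion) : x * e 0 = x := by
  ext k
  rw [mul_apply, Finset.sum_comm, Finset.sum_eq_single 0 _ (by simp)]
  · simp [structConst_zero_right, e]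
  · intro i _ hi
    simp [e, hi]

/-- The multiplication table in coordinates. -/
theorem mul_eq (x y : Octonion) : x * y = WithLp.toLp 2
    ![x 0 * y 0 - x 1 * y 1 - x 2 * y 2 - x 3 * y 3 - x 4 * y 4 - x 5 * y 5 - x 6 * y 6 - x 7 * y 7,
      x 0 * y 1 + x 1 * y 0 + x 2 * y 3 - x 3 * y 2 + x 4 * y 5 - x 5 * y 4 + x 7 * y 6 - x 6 * y 7,
      x 0 * y 2 + x 2 * y 0 + x 3 * y 1 - x 1 * y 3 + x 4 * y 6 - x 6 * y 4 + x 5 * y 7 - x 7 * y 5,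
      x 0 * y 3 + x 3 * y 0 + x 1 * y 2 - x 2 * y 1 + x 4 * y 7 - x 7 * y 4 + x 6 * y 5 - x 5 * y 6,
      x 0 * y 4 + x 4 * y 0 + x 5 * y 1 - x 1 * y 5 + x 6 * y 2 - x 2 * y 6 + x 7 * y 3 - x 3 * y 7,
      x 0 * y 5 + x 5 * y 0 + x 1 * y 4 - x 4 * y 1 + x 3 * y 6 - x 6 * y 3 + x 7 * y 2 - x 2 * y 7,
      x 0 * y 6 + x 6 * y 0 + x 2 * y 4 - x 4 * y 2 + x 5 * y 3 - x 3 * y 5 + x 1 * y 7 - x 7 * y 1,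
      x 0 * y 7 + x 7 * y 0 + x 3 * y 4 - x 4 * y 3 + x 6 * y 1 - x 1 * y 6 + x 2 * y 5 - x 5 * y 2]
    := by
  ext k
  fin_cases k <;>
  · simp [mul_apply, Fin.sum_univ_eight, structConst, epsilon, triples]
    try ring

/-- Degen's eight-square identity: the norm is multiplicative. -/
theorem sum_mul_apply_sq (x y : Octonion) :
    ∑ i, (x * y) i ^ 2 = (∑ i, x i ^ 2) * ∑ i, y i ^ 2 := by
  simp only [mul_eq, Fin.sum_univ_eight]
  simp
  ring

/-- The cross terms cancel because `epsilon` is antisymmetric. -/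
theorem mul_self_of_apply_zero {x : Octonion} (hx : x 0 = 0) :
    x * x = -(∑ i, x i ^ 2) • e 0 := by
  ext k
  fin_cases k <;>
  · simp [mul_eq, Fin.sum_univ_eight, e, hx]
    try ring

theorem mul_apply_zero (x y : Octonion) : (x * y) 0 = 2 * (x 0 * y 0) - ∑ i, x i * y i := by
  simp only [mul_eq, Fin.sum_univ_eight]
  simp
  ring

/-- The coordinates of `ω` and of `ofHead p t` have disjoint supports and `ω 0 = 0`, so the product
has no real part; its norm is that of `t`. -/
theorem mul_self_mul_ofHead {p : Fin 7} {ω : Octonion} (hω : ω ∈ unitSphere p)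
    (t : Fin (p.val + 1) → ℝ) :
    (ω * ofHead p t) * (ω * ofHead p t) = -(∑ l, t l ^ 2) • e 0 := by
  rw [mul_self_of_apply_zero, sum_mul_apply_sq, hω.2, one_mul]
  · congr 2
    symm
    refine Finset.sum_of_injOn (idx p) (Fin.castLE_injective _).injOn (by simp) ?_ ?_
    · intro i _ hi
      rw [ofHead_apply, dif_neg, zero_pow two_ne_zero]
      intro h
      exact hi ⟨⟨i, h⟩, by simp, rfl⟩
    · intro l _
      rw [ofHead_apply, dif_pos (show (idx p l).val < p.val + 1 from l.2)]
      rfl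
  · rw [mul_apply_zero, hω.1 0 (Nat.zero_le _), zero_mul, mul_zero, Finset.sum_eq_zero, sub_zero]
    intro i _
    by_cases h : i.val ≤ p.val
    · rw [hω.1 i h, zero_mul]
    · rw [ofHead_apply, dif_neg (by omega), mul_zero]

/-! ## Powers -/

/-- The linear map from a quadratic algebra that takes the adjoined square root to `u`. -/
def ofQuadratic (N : ℝ) (u : Octonion) (z : QuadraticAlgebra ℝ N 0) : Octonion :=
  z.re • e 0 + z.im • u

/-- Bilinearity, the unit and `hu` suffice; no associativity of the octonions enters. -/
theorem ofQuadratic_mul {N : ℝ} {u : Octonion} (hu : u * u = N • e 0)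
    (z w : QuadraticAlgebra ℝ N 0) :
    ofQuadratic N u (z * w) = ofQuadratic N u z * ofQuadratic N u w := by
  simp only [ofQuadratic, QuadraticAlgebra.re_mul, QuadraticAlgebra.im_mul, add_mul, mul_add,
    smul_mul_assoc, mul_smul_comm, hu, e_zero_mul, mul_e_zero]
  module

theorem Bracketing.prod_ofQuadratic {N : ℝ} {u : Octonion} (hu : u * u = N • e 0)
    (z : QuadraticAlgebra ℝ N 0) {n : ℕ} (B : Bracketing n) :
    B.prod (fun _ => ofQuadratic N u z) = ofQuadratic N u (z ^ n) := by
  induction B with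
  | leaf => simp [Bracketing.prod]
  | node a b ha hb => rw [Bracketing.prod, ha, hb, pow_add, ofQuadratic_mul hu]

/-- The bracketing of a product from left to right. -/
def Bracketing.left : (n : ℕ) → Bracketing (n + 1)
  | 0 => .leaf
  | n + 1 => .node (Bracketing.left n) .leaf

theorem Bracketing.prod_left (n : ℕ) (v : Fin (n + 1) → Octonion) :
    (Bracketing.left n).prod v = leftProd (n + 1) v := by
  induction n with
  | zero => rfl
  | succ n ih => exact congrArg (· * v (Fin.last (n + 1))) (ih fun i => v i.castSucc)

theorem leftProd_ofQuadratic {N : ℝ} {u : Octonion} (hu : u * u = N • e 0)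
    (z : QuadraticAlgebra ℝ N 0) (n : ℕ) :
    leftProd n (fun _ => ofQuadratic N u z) = ofQuadratic N u (z ^ n) := by
  cases n with
  -- There is no bracketing of zero factors, so the empty product is treated apart.
  | zero =>
    rw [pow_zero]
    simp [leftProd, ofQuadratic, QuadraticAlgebra.re_one, QuadraticAlgebra.im_one]
  | succ n => rw [← Bracketing.prod_left, Bracketing.prod_ofQuadratic hu]

theorem _root_.Finset.sum_range_two_mul {M : Type*} [AddCommMonoid M] (f : ℕ → M) (n : ℕ) :
    ∑ m ∈ Finset.range (2 * n), f m = ∑ j ∈ Finset.range n, (f (2 * j) + f (2 * j + 1)) := by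
  induction n with
  | zero => simp
  | succ n ih => rw [mul_add, mul_one, Finset.sum_range_succ, Finset.sum_range_succ, ih,
      Finset.sum_range_succ, add_assoc]

/-- The binomial theorem split by parity: even powers of the square root are scalars and odd ones
are purely imaginary. Terms beyond degree `n` carry a zero binomial coefficient. -/
theorem _root_.QuadraticAlgebra.mk_pow_eq_sum (N a b : ℝ) (n : ℕ) :
    (⟨a, b⟩ : QuadraticAlgebra ℝ N 0) ^ n =
      ⟨∑ j ∈ Finset.range (n + 1), n.choose (2 * j) * (a ^ (n - 2 * j) * b ^ (2 * j) * N ^ j),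
        ∑ j ∈ Finset.range (n + 1),
          n.choose (2 * j + 1) * (a ^ (n - (2 * j + 1)) * b ^ (2 * j + 1) * N ^ j)⟩ := by
  have hz : (⟨a, b⟩ : QuadraticAlgebra ℝ N 0) = ⟨0, b⟩ + algebraMap ℝ _ a := by
    ext <;> simp
  have heven : ∀ j : ℕ, (⟨0, b⟩ : QuadraticAlgebra ℝ N 0) ^ (2 * j) =
      algebraMap ℝ _ (b ^ (2 * j) * N ^ j) := by
    intro j
    rw [pow_mul, pow_mul, ← mul_pow, map_pow]
    congr 1
    ext <;> simp [pow_two, mul_comm, mul_left_comm]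
  have hodd : ∀ j : ℕ, (⟨0, b⟩ : QuadraticAlgebra ℝ N 0) ^ (2 * j + 1) =
      ⟨0, b ^ (2 * j + 1) * N ^ j⟩ := by
    intro j
    rw [pow_succ, heven]
    ext
    · simp [-map_mul, -map_pow]
    · simp [-map_mul, -map_pow]
      ring
  -- The range is lengthened to an even number of terms so that they pair up as `2 * j` and `2 * j +
  -- 1`.
  have hsum : (⟨a, b⟩ : QuadraticAlgebra ℝ N 0) ^ n = ∑ m ∈ Finset.range (2 * (n + 1)),
      (⟨0, b⟩ : QuadraticAlgebra ℝ N 0) ^ m * algebraMap ℝ _ (a ^ (n - m) * n.choose m) := by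
    rw [hz, add_pow]
    refine Finset.sum_subset_zero_on_sdiff (Finset.range_subset_range.2 (by omega)) ?_ ?_
    · intro m hm
      rw [Nat.choose_eq_zero_of_lt (by simp at hm; omega)]
      simp
    · intro m _
      simp [mul_assoc]
  rw [hsum, Finset.sum_range_two_mul]
  simp only [heven, hodd]
  ext
  · rw [← QuadraticAlgebra.reₗ_apply, map_sum]
    refine Finset.sum_congr rfl fun j _ => ?_
    simp [-map_mul, -map_pow]
    ring
  · rw [← QuadraticAlgebra.imₗ_apply, map_sum]
    refine Finset.sum_congr rfl fun j _ => ?_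
    simp [-map_mul, -map_pow]
    ring

/-! ## Polarization -/

section Polarization

variable {ι : Type*} [Fintype ι]

theorem Bracketing.prod_sum (t : ι → ℝ) (v : ι → Octonion) {n : ℕ} (B : Bracketing n) :
    B.prod (fun _ => ∑ l, t l • v l) =
      ∑ s : Fin n → ι, (∏ m, t (s m)) • B.prod fun m => v (s m) := by
  induction B with
  | leaf =>
    rw [← (Equiv.funUnique (Fin 1) ι).symm.sum_comp]
    simp [Bracketing.prod]
  | @node m n a b ha hb =>
    rw [Bracketing.prod, ha, hb, ← (Fin.appendEquiv m n).sum_comp, Fintype.sum_prod_type,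
      Finset.sum_mul_sum]
    refine Finset.sum_congr rfl fun s _ => Finset.sum_congr rfl fun s' _ => ?_
    simp [Bracketing.prod, Fin.prod_univ_add, Fin.appendEquiv, smul_mul_assoc, mul_smul_comm,
      smul_smul]
    rw [mul_comm]

theorem leftProd_sum (t : ι → ℝ) (v : ι → Octonion) (n : ℕ) :
    leftProd n (fun _ => ∑ l, t l • v l) =
      ∑ s : Fin n → ι, (∏ m, t (s m)) • leftProd n fun m => v (s m) := by
  cases n with
  | zero => simp [leftProd]
  | succ n =>
    rw [← Bracketing.prod_left, Bracketing.prod_sum]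
    simp only [Bracketing.prod_left]

variable [DecidableEq ι]

/-- The weight of a sequence depends only on how often each index occurs, so the sum is taken fibre
by fibre. -/
theorem sum_smul_eq_sum_piAntidiag {M : Type*} [AddCommGroup M] [Module ℝ M] (t : ι → ℝ) (n : ℕ)
    (F : (Fin n → ι) → M) {S : (ι → ℕ) → Finset (Fin n → ι)}
    (hS : ∀ k s, s ∈ S k ↔ ∀ l, (Finset.univ.filter fun m => s m = l).card = k l) :
    ∑ s, (∏ m, t (s m)) • F s =
      ∑ k ∈ Finset.piAntidiag Finset.univ n, (∏ l, t l ^ k l) • ∑ s ∈ S k, F s := by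
  have hmaps : ∀ s ∈ (Finset.univ : Finset (Fin n → ι)),
      (fun l => (Finset.univ.filter fun m => s m = l).card) ∈
        Finset.piAntidiag Finset.univ n := by
    intro s _
    simp only [Finset.mem_piAntidiag, Finset.mem_univ, implies_true, and_true]
    rw [← Finset.card_eq_sum_card_fiberwise fun _ _ => Finset.mem_coe.2 (Finset.mem_univ _)]
    simp
  rw [← Finset.sum_fiberwise_of_maps_to hmaps]
  refine Finset.sum_congr rfl fun k _ => ?_
  rw [Finset.smul_sum]
  refine Finset.sum_congr (by ext s; simp [hS, funext_iff]) fun s hs => ?_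
  rw [hS] at hs
  congr 1
  rw [← Finset.prod_fiberwise Finset.univ s]
  refine Finset.prod_congr rfl fun l _ => ?_
  rw [← hs l, Finset.prod_congr rfl (g := fun _ => t l), Finset.prod_const]
  intro m hm
  rw [(Finset.mem_filter.1 hm).2]

/-- In each octonion coordinate, both sides are real polynomials in `t`, and a polynomial over an
infinite field is determined by its values. -/
theorem eq_of_sum_piAntidiag_smul_eq {n : ℕ} {A B : (ι → ℕ) → Octonion}
    (h : ∀ t : ι → ℝ, ∑ k ∈ Finset.piAntidiag Finset.univ n, (∏ l, t l ^ k l) • A k =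
      ∑ k ∈ Finset.piAntidiag Finset.univ n, (∏ l, t l ^ k l) • B k)
    {k : ι → ℕ} (hk : ∑ l, k l = n) : A k = B k := by
  ext c
  let P : ((ι → ℕ) → Octonion) → MvPolynomial ι ℝ := fun A =>
    ∑ k ∈ Finset.piAntidiag Finset.univ n,
      MvPolynomial.monomial (Finsupp.equivFunOnFinite.symm k) (A k c)
  have hcoeff : ∀ A, (P A).coeff (Finsupp.equivFunOnFinite.symm k) = A k c := by
    intro A
    simp only [P, MvPolynomial.coeff_sum, MvPolynomial.coeff_monomial, EmbeddingLike.apply_eq_iff_eq]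
    rw [Finset.sum_ite_eq']
    simp [hk]
  have heval : ∀ A t, MvPolynomial.eval t (P A) =
      (∑ k ∈ Finset.piAntidiag Finset.univ n, (∏ l, t l ^ k l) • A k) c := by
    intro A t
    simp [P, MvPolynomial.eval_monomial, Finsupp.prod_fintype, mul_comm]
  rw [← hcoeff A, ← hcoeff B, MvPolynomial.funext (p := P A) (q := P B)]
  intro t
  rw [heval, heval, h]

end Polarization

/-! ## Differential operators on smooth functions -/

section Smooth

open scoped ContDiff

variable {p : Fin 7}

theorem partialDeriv_eq_fderiv {f : (Fin (p.val + 1) → ℝ) → Octonion} (hf : ContDiff ℝ ∞ f)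
    (l : Fin (p.val + 1)) : partialDeriv l f = fun y => fderiv ℝ f y (Pi.single l 1) :=
  funext fun y => ((hf.differentiable (by simp)) y).lineDeriv_eq_fderiv

theorem contDiff_partialDeriv {f : (Fin (p.val + 1) → ℝ) → Octonion} (hf : ContDiff ℝ ∞ f)
    (l : Fin (p.val + 1)) : ContDiff ℝ ∞ (partialDeriv l f) := by
  rw [partialDeriv_eq_fderiv hf]
  exact (hf.fderiv_right (m := ∞) (by simp)).clm_apply contDiff_const

theorem contDiff_negLaplacian {f : (Fin (p.val + 1) → ℝ) → Octonion} (hf : ContDiff ℝ ∞ f) :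
    ContDiff ℝ ∞ (negLaplacian f) :=
  (ContDiff.sum fun l _ => contDiff_partialDeriv (contDiff_partialDeriv hf l) l).neg

theorem contDiff_const_mul (c : Octonion) {f : (Fin (p.val + 1) → ℝ) → Octonion}
    (hf : ContDiff ℝ ∞ f) : ContDiff ℝ ∞ fun y => c * f y :=
  (LinearMap.toContinuousLinearMap (LinearMap.mulLeft ℝ c)).contDiff.comp hf

theorem contDiff_cauchyRiemann {f : (Fin (p.val + 1) → ℝ) → Octonion} (hf : ContDiff ℝ ∞ f) :
    ContDiff ℝ ∞ (cauchyRiemann f) :=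
  ContDiff.sum fun l _ => contDiff_const_mul _ (contDiff_partialDeriv hf l)

variable {κ : Type*} (s : Finset κ) (c : κ → ℝ) {f : κ → (Fin (p.val + 1) → ℝ) → Octonion}

/-- Smoothness matters because `lineDeriv` is `0` where no derivative exists, so it is not additive
in general. -/
theorem partialDeriv_sum (hf : ∀ k, ContDiff ℝ ∞ (f k)) (l : Fin (p.val + 1)) :
    partialDeriv l (fun y => ∑ k ∈ s, c k • f k y) =
      fun y => ∑ k ∈ s, c k • partialDeriv l (f k) y := by
  have hd : ∀ k y, DifferentiableAt ℝ (f k) y := fun k => (hf k).differentiable (by simp)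
  rw [partialDeriv_eq_fderiv (ContDiff.sum fun k _ => (hf k).const_smul (c k))]
  funext y
  rw [fderiv_fun_sum (A := fun k y => c k • f k y) fun k _ => (hd k y).const_smul (c k)]
  simp only [partialDeriv_eq_fderiv (hf _), sum_apply]
  refine Finset.sum_congr rfl fun k _ => ?_
  rw [fderiv_fun_const_smul (hd k y)]
  rfl

theorem negLaplacian_sum (hf : ∀ k, ContDiff ℝ ∞ (f k)) :
    negLaplacian (fun y => ∑ k ∈ s, c k • f k y) =
      fun y => ∑ k ∈ s, c k • negLaplacian (f k) y := by
  funext y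
  simp only [negLaplacian, partialDeriv_sum s c hf,
    partialDeriv_sum s c (fun k => contDiff_partialDeriv (hf k) _)]
  rw [Finset.sum_comm]
  simp only [smul_neg, Finset.smul_sum, Finset.sum_neg_distrib]

theorem cauchyRiemann_sum (hf : ∀ k, ContDiff ℝ ∞ (f k)) :
    cauchyRiemann (fun y => ∑ k ∈ s, c k • f k y) =
      fun y => ∑ k ∈ s, c k • cauchyRiemann (f k) y := by
  funext y
  simp only [cauchyRiemann, partialDeriv_sum s c hf, Finset.mul_sum, mul_smul_comm]
  rw [Finset.sum_comm]
  simp only [Finset.smul_sum]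

theorem iterate_negLaplacian_sum (hf : ∀ k, ContDiff ℝ ∞ (f k)) (j : ℕ) :
    negLaplacian^[j] (fun y => ∑ k ∈ s, c k • f k y) =
      fun y => ∑ k ∈ s, c k • negLaplacian^[j] (f k) y := by
  -- The innermost operator is peeled off, so the induction hypothesis is applied to `negLaplacian
  -- (f k)`.
  induction j generalizing f with
  | zero => rfl
  | succ j ih =>
    simp only [Function.iterate_succ_apply, negLaplacian_sum s c hf,
      ih fun k => contDiff_negLaplacian (hf k)]

theorem contDiff_monomialFun (k : Fin (p.val + 1) → ℕ) : ContDiff ℝ ∞ (monomialFun k) := by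
  unfold monomialFun
  fun_prop

end Smooth

/-! ## Powers of linear forms -/

section LinearPower

variable {p : Fin 7}

/-- The power `(∑ t_l x_l) ^ n c` of a linear form with an octonion coefficient. -/
def linearPow (t : Fin (p.val + 1) → ℝ) (n : ℕ) (c : Octonion) : (Fin (p.val + 1) → ℝ) → Octonion :=
  fun y => (∑ l, t l * y l) ^ n • c

/-- The truncated exponent at `n = 0` is harmless, since the factor `n` vanishes; the falling
factorials below play the same role. -/
theorem partialDeriv_linearPow (t : Fin (p.val + 1) → ℝ) (n : ℕ) (c : Octonion)
    (l : Fin (p.val + 1)) :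
    partialDeriv l (linearPow t n c) = linearPow t (n - 1) ((n * t l) • c) := by
  funext y
  have h : HasDerivAt (fun s : ℝ => linearPow t n c (y + s • (Pi.single l 1 : Fin (p.val + 1) → ℝ)))
      (linearPow t (n - 1) ((n * t l) • c) y) 0 := by
    have hline : ∀ s : ℝ, ∑ i, t i * (y + s • (Pi.single l 1 : Fin (p.val + 1) → ℝ)) i = (∑ i, t i * y i) + s * t l := by
      intro s
      simp [mul_add, Finset.sum_add_distrib, Pi.single_apply, mul_comm]
    simp only [linearPow, hline]
    have := ((((hasDerivAt_id (0 : ℝ)).mul_const (t l)).const_add (∑ i, t i * y i)).pow n).smul_const c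
    refine this.congr_deriv ?_
    simp only [id_eq, zero_mul, add_zero, one_mul, smul_smul]
    congr 1
    ring
  exact HasLineDerivAt.lineDeriv h

theorem negLaplacian_linearPow (t : Fin (p.val + 1) → ℝ) (n : ℕ) (c : Octonion) :
    negLaplacian (linearPow t n c) =
      linearPow t (n - 2) ((-(∑ l, t l ^ 2) * n.descFactorial 2) • c) := by
  funext y
  simp only [negLaplacian, partialDeriv_linearPow, linearPow, smul_smul, ← Finset.sum_smul,
    ← neg_smul, Nat.sub_sub, Nat.descFactorial_succ]
  congr 1
  simp only [Nat.cast_mul, ← Finset.mul_sum, neg_mul, mul_neg, neg_inj, Finset.sum_mul]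
  simp only [Finset.mul_sum]
  refine Finset.sum_congr rfl fun l _ => ?_
  simp only [Nat.sub_zero, Nat.descFactorial_zero, Nat.cast_one, mul_one]
  ring

theorem iterate_negLaplacian_linearPow (t : Fin (p.val + 1) → ℝ) (n : ℕ) (c : Octonion) (j : ℕ) :
    negLaplacian^[j] (linearPow t n c) =
      linearPow t (n - 2 * j) (((-(∑ l, t l ^ 2)) ^ j * n.descFactorial (2 * j)) • c) := by
  induction j with
  | zero => simp
  | succ j ih =>
    rw [Function.iterate_succ_apply', ih, negLaplacian_linearPow, smul_smul, Nat.sub_sub, mul_add,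
      mul_one]
    congr 2
    simp only [Nat.descFactorial_succ, Nat.descFactorial_zero, Nat.sub_zero, Nat.sub_sub]
    push_cast
    ring

theorem cauchyRiemann_linearPow (t : Fin (p.val + 1) → ℝ) (n : ℕ) :
    cauchyRiemann (linearPow t n (e 0)) = linearPow t (n - 1) ((n : ℝ) • ofHead p t) := by
  funext y
  simp only [cauchyRiemann, partialDeriv_linearPow, linearPow, mul_smul_comm, mul_e_zero, ofHead,
    Finset.smul_sum, smul_smul]

theorem linearPow_eq_sum (t : Fin (p.val + 1) → ℝ) (n : ℕ) :
    linearPow t n (e 0) = fun y => ∑ k ∈ Finset.piAntidiag Finset.univ n,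
      ((n.factorial : ℝ) * ((∏ l, t l ^ k l) * ((∏ l, (k l).factorial : ℕ) : ℝ)⁻¹)) •
        monomialFun k y := by
  funext y
  simp only [linearPow, monomialFun, smul_smul, ← Finset.sum_smul]
  rw [Finset.sum_pow_eq_sum_piAntidiag]
  congr 1
  refine Finset.sum_congr rfl fun k hk => ?_
  have hspec := Nat.multinomial_spec Finset.univ k
  rw [(Finset.mem_piAntidiag.1 hk).1] at hspec
  have hne : ((∏ l, (k l).factorial : ℕ) : ℝ) ≠ 0 :=
    Nat.cast_ne_zero.2 (Finset.prod_ne_zero_iff.2 fun l _ => Nat.factorial_ne_zero _)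
  rw [← hspec, Nat.cast_mul]
  simp only [mul_pow, Finset.prod_mul_distrib]
  field_simp

/-- The generating identity for the even terms of the extensions of the monomials. -/
theorem sum_iterate_negLaplacian_monomialFun (t y : Fin (p.val + 1) → ℝ) (n j : ℕ) :
    ∑ k ∈ Finset.piAntidiag Finset.univ n, (∏ l, t l ^ k l) •
        ((∏ l, (k l).factorial : ℕ) : ℝ)⁻¹ • negLaplacian^[j] (monomialFun k) y =
      ((n.factorial : ℝ)⁻¹ * n.descFactorial (2 * j) *
        ((-(∑ l, t l ^ 2)) ^ j * (∑ l, t l * y l) ^ (n - 2 * j))) • e 0 := by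
  -- `(-Δ)^j` of the power of the linear form is evaluated directly and through the multinomial
  -- expansion; then `n!` is divided out.
  have h := congrFun (iterate_negLaplacian_linearPow t n (e 0) j) y
  rw [linearPow_eq_sum, iterate_negLaplacian_sum _ _ contDiff_monomialFun] at h
  have h' := congrArg ((n.factorial : ℝ)⁻¹ • ·) h
  simp only [Finset.smul_sum, smul_smul, linearPow] at h' ⊢
  have hn : (n.factorial : ℝ) ≠ 0 := Nat.cast_ne_zero.2 n.factorial_ne_zero
  simp only [inv_mul_cancel_left₀ hn] at h'
  rw [h']
  congr 1
  ring

/-- The generating identity for the odd terms of the extensions of the monomials. -/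
theorem sum_iterate_negLaplacian_cauchyRiemann_monomialFun (t y : Fin (p.val + 1) → ℝ) (n j : ℕ) :
    ∑ k ∈ Finset.piAntidiag Finset.univ n, (∏ l, t l ^ k l) •
        ((∏ l, (k l).factorial : ℕ) : ℝ)⁻¹ • negLaplacian^[j] (cauchyRiemann (monomialFun k)) y =
      ((n.factorial : ℝ)⁻¹ * n.descFactorial (2 * j + 1) *
        ((-(∑ l, t l ^ 2)) ^ j * (∑ l, t l * y l) ^ (n - (2 * j + 1)))) • ofHead p t := by
  have h := congrFun (iterate_negLaplacian_linearPow t (n - 1) ((n : ℝ) • ofHead p t) j) y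
  rw [← cauchyRiemann_linearPow, linearPow_eq_sum, cauchyRiemann_sum _ _ contDiff_monomialFun,
    iterate_negLaplacian_sum _ _ fun k => contDiff_cauchyRiemann (contDiff_monomialFun k)] at h
  have h' := congrArg ((n.factorial : ℝ)⁻¹ • ·) h
  simp only [Finset.smul_sum, smul_smul, linearPow] at h' ⊢
  have hn : (n.factorial : ℝ) ≠ 0 := Nat.cast_ne_zero.2 n.factorial_ne_zero
  simp only [inv_mul_cancel_left₀ hn] at h'
  rw [h']
  -- The first factor `n` comes from the Cauchy-Riemann operator, the others from the Laplacians.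
  have hdesc : n.descFactorial (2 * j + 1) = n * (n - 1).descFactorial (2 * j) := by
    cases n with
    | zero => simp
    | succ n => rw [Nat.succ_descFactorial_succ, Nat.add_sub_cancel]
  rw [hdesc, Nat.sub_sub, Nat.add_comm 1, Nat.cast_mul]
  congr 1
  ring

end LinearPower

/-! ## The extensions of the monomials -/

section Extension

variable {p : Fin 7}

theorem factorial_inv_smul_eq_zero_iff (k : Fin (p.val + 1) → ℕ) (v : Octonion) :
    ((∏ l, (k l).factorial : ℕ) : ℝ)⁻¹ • v = 0 ↔ v = 0 :=
  smul_eq_zero_iff_right (inv_ne_zero (Nat.cast_ne_zero.2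
    (Finset.prod_ne_zero_iff.2 fun _ _ => Nat.factorial_ne_zero _)))

/-- The generating identity has a vanishing falling factorial here, so each of its coefficients
vanishes. This reduces the series of the extension to finite sums. -/
theorem iterate_negLaplacian_monomialFun_eq_zero (k : Fin (p.val + 1) → ℕ) {j : ℕ}
    (hj : degree k < 2 * j) (y : Fin (p.val + 1) → ℝ) : negLaplacian^[j] (monomialFun k) y = 0 := by
  rw [← factorial_inv_smul_eq_zero_iff k]
  refine eq_of_sum_piAntidiag_smul_eq (n := degree k) (B := 0)
    (A := fun k => ((∏ l, (k l).factorial : ℕ) : ℝ)⁻¹ • negLaplacian^[j] (monomialFun k) y)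
    (fun t => ?_) rfl
  rw [sum_iterate_negLaplacian_monomialFun, Nat.descFactorial_of_lt hj]
  simp

theorem iterate_negLaplacian_cauchyRiemann_monomialFun_eq_zero (k : Fin (p.val + 1) → ℕ) {j : ℕ}
    (hj : degree k < 2 * j + 1) (y : Fin (p.val + 1) → ℝ) :
    negLaplacian^[j] (cauchyRiemann (monomialFun k)) y = 0 := by
  rw [← factorial_inv_smul_eq_zero_iff k]
  refine eq_of_sum_piAntidiag_smul_eq (n := degree k) (B := 0)
    (A := fun k => ((∏ l, (k l).factorial : ℕ) : ℝ)⁻¹ •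
      negLaplacian^[j] (cauchyRiemann (monomialFun k)) y)
    (fun t => ?_) rfl
  rw [sum_iterate_negLaplacian_cauchyRiemann_monomialFun, Nat.descFactorial_of_lt hj]
  simp

theorem ckAt_monomialFun (k : Fin (p.val + 1) → ℕ) (y : Fin (p.val + 1) → ℝ) (r : ℝ)
    (ω : Octonion) : ckAt (monomialFun k) y r ω =
      ∑ j ∈ Finset.range (degree k + 1), ((r ^ (2 * j) / ((2 * j).factorial : ℝ)) •
          negLaplacian^[j] (monomialFun k) y +
        (r ^ (2 * j + 1) / ((2 * j + 1).factorial : ℝ)) •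
          (ω * negLaplacian^[j] (cauchyRiemann (monomialFun k)) y)) := by
  rw [ckAt, tsum_eq_sum (s := Finset.range (degree k + 1)),
    tsum_eq_sum (s := Finset.range (degree k + 1)), Finset.mul_sum, ← Finset.sum_add_distrib]
  · simp only [mul_smul_comm]
  · intro j hj
    rw [iterate_negLaplacian_cauchyRiemann_monomialFun_eq_zero k (by simp at hj; omega), smul_zero]
  · intro j hj
    rw [iterate_negLaplacian_monomialFun_eq_zero k (by simp at hj; omega), smul_zero]

theorem sum_smul_fueterVarAt (t y : Fin (p.val + 1) → ℝ) (r : ℝ) (ω : Octonion) :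
    ∑ l, t l • fueterVarAt p y r ω l =
      ofQuadratic (-(∑ l, t l ^ 2)) (ω * ofHead p t) ⟨∑ l, t l * y l, r⟩ := by
  simp only [fueterVarAt, ofQuadratic, ofHead, smul_add, Finset.sum_add_distrib, Finset.mul_sum,
    Finset.smul_sum, Finset.sum_smul, smul_smul, smul_mul_assoc, mul_smul_comm]
  congr 1
  exact Finset.sum_congr rfl fun l _ => by rw [mul_comm]

/-- The generating identity for the extensions of the monomials. -/
theorem sum_smul_ckAt_monomialFun (t y : Fin (p.val + 1) → ℝ) (r : ℝ) (ω : Octonion) (n : ℕ) :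
    ∑ k ∈ Finset.piAntidiag Finset.univ n, (∏ l, t l ^ k l) •
        ((∏ l, (k l).factorial : ℕ) : ℝ)⁻¹ • ckAt (monomialFun k) y r ω =
      (n.factorial : ℝ)⁻¹ • ofQuadratic (-(∑ l, t l ^ 2)) (ω * ofHead p t)
        (⟨∑ l, t l * y l, r⟩ ^ n) := by
  have hck : ∀ k ∈ Finset.piAntidiag Finset.univ n, (∏ l, t l ^ k l) •
      ((∏ l, (k l).factorial : ℕ) : ℝ)⁻¹ • ckAt (monomialFun k) y r ω =
      ∑ j ∈ Finset.range (n + 1), ((r ^ (2 * j) / ((2 * j).factorial : ℝ)) • (∏ l, t l ^ k l) •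
          ((∏ l, (k l).factorial : ℕ) : ℝ)⁻¹ • negLaplacian^[j] (monomialFun k) y +
        (r ^ (2 * j + 1) / ((2 * j + 1).factorial : ℝ)) • (ω * ((∏ l, t l ^ k l) •
          ((∏ l, (k l).factorial : ℕ) : ℝ)⁻¹ •
            negLaplacian^[j] (cauchyRiemann (monomialFun k)) y))) := by
    intro k hk
    have hdeg : degree k = n := (Finset.mem_piAntidiag.1 hk).1
    rw [ckAt_monomialFun, hdeg, Finset.smul_sum, Finset.smul_sum]
    refine Finset.sum_congr rfl fun j _ => ?_
    simp only [mul_smul_comm, smul_add, smul_smul]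
    congr 2 <;> ring
  -- Dividing by the factorials of the series turns the falling factorials into the binomial
  -- coefficients of the `n`-th power.
  have hchoose : ∀ m, (n.descFactorial m : ℝ) = m.factorial * n.choose m := fun m => by
    exact_mod_cast Nat.descFactorial_eq_factorial_mul_choose n m
  have hfac : ∀ m : ℕ, (m.factorial : ℝ) ≠ 0 := fun m => Nat.cast_ne_zero.2 m.factorial_ne_zero
  rw [Finset.sum_congr rfl hck, Finset.sum_comm]
  simp only [Finset.sum_add_distrib, ← Finset.smul_sum, ← Finset.mul_sum,
    sum_iterate_negLaplacian_monomialFun, sum_iterate_negLaplacian_cauchyRiemann_monomialFun]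
  rw [QuadraticAlgebra.mk_pow_eq_sum, ofQuadratic, smul_add]
  simp only [Finset.sum_smul, Finset.smul_sum, mul_smul_comm, smul_smul]
  congr 1
  · refine Finset.sum_congr rfl fun j _ => ?_
    rw [hchoose]
    congr 1
    field_simp [hfac (2 * j)]
  · refine Finset.sum_congr rfl fun j _ => ?_
    rw [hchoose]
    congr 1
    field_simp [hfac (2 * j + 1)]

/-- The index sequences of length `n` that take each value `l` exactly `k l` times. -/
def arrangements (n : ℕ) (k : Fin (p.val + 1) → ℕ) : Finset (Fin n → Fin (p.val + 1)) :=
  Finset.univ.filter fun s => ∀ l, (Finset.univ.filter fun m => s m = l).card = k l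

theorem mem_arrangements {n : ℕ} (k : Fin (p.val + 1) → ℕ) (s : Fin n → Fin (p.val + 1)) :
    s ∈ arrangements n k ↔ ∀ l, (Finset.univ.filter fun m => s m = l).card = k l := by
  simp [arrangements]

/-- The length `n` is a separate variable because the comparison of coefficients lets `k` range over
all multi-indices of degree `n`. For `n = degree k` the arrangements are the alignments by
definition. -/
theorem ckMonomial_eq_sum_leftProd (x : Octonion) {n : ℕ} {k : Fin (p.val + 1) → ℕ}
    (hk : ∑ l, k l = n) : ckMonomial k x = (n.factorial : ℝ)⁻¹ •
      ∑ s ∈ arrangements n k, leftProd n fun m => fueterVar p (s m) x := by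
  refine eq_of_sum_piAntidiag_smul_eq (A := fun k => ckMonomial k x)
    (B := fun k => (n.factorial : ℝ)⁻¹ •
      ∑ s ∈ arrangements n k, leftProd n fun m => fueterVar p (s m) x) (fun t => ?_) hk
  have hsq := mul_self_mul_ofHead (eq_head_add p x).2.2 t
  simp only [smul_comm _ (n.factorial : ℝ)⁻¹, ← Finset.smul_sum]
  rw [← sum_smul_eq_sum_piAntidiag t n (fun s => leftProd n fun m => fueterVar p (s m) x)
      mem_arrangements, ← leftProd_sum t (fun l => fueterVar p l x)]
  simp only [fueterVar, sum_smul_fueterVarAt, leftProd_ofQuadratic hsq]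
  exact sum_smul_ckAt_monomialFun t (headPart p x) (radius p x) (direction p x) n

theorem sum_bracketing_prod_eq_sum_leftProd (x : Octonion) {n : ℕ} (B : Bracketing n)
    {k : Fin (p.val + 1) → ℕ} (hk : ∑ l, k l = n) :
    ∑ s ∈ arrangements n k, B.prod (fun m => fueterVar p (s m) x) =
      ∑ s ∈ arrangements n k, leftProd n fun m => fueterVar p (s m) x := by
  refine eq_of_sum_piAntidiag_smul_eq
    (A := fun k => ∑ s ∈ arrangements n k, B.prod fun m => fueterVar p (s m) x)
    (B := fun k => ∑ s ∈ arrangements n k, leftProd n fun m => fueterVar p (s m) x)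
    (fun t => ?_) hk
  have hsq := mul_self_mul_ofHead (eq_head_add p x).2.2 t
  rw [← sum_smul_eq_sum_piAntidiag t n (fun s => leftProd n fun m => fueterVar p (s m) x)
      mem_arrangements,
    ← sum_smul_eq_sum_piAntidiag t n (fun s => B.prod fun m => fueterVar p (s m) x)
      mem_arrangements,
    ← leftProd_sum t (fun l => fueterVar p l x), ← B.prod_sum t (fun l => fueterVar p l x)]
  simp only [fueterVar, sum_smul_fueterVarAt, leftProd_ofQuadratic hsq,
    Bracketing.prod_ofQuadratic hsq]

end Extension

end

end OctonionFueter

theorem mainTheorem10 (p : Fin 7) (k : Fin (p.val + 1) → ℕ) (x : OctonionFueter.Octonion) :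
    OctonionFueter.ckMonomial k x = OctonionFueter.fueterPoly k x ∧
      ∀ B : OctonionFueter.Bracketing (OctonionFueter.degree k),
        OctonionFueter.fueterPolyWith k B x = OctonionFueter.fueterPoly k x :=
  ⟨OctonionFueter.ckMonomial_eq_sum_leftProd x rfl, fun B => congrArg _
    (OctonionFueter.sum_bracketing_prod_eq_sum_leftProd x B rfl)⟩
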